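/- Consider a finite-horizon robust MDP with nonempty finite state space $S$, nonempty finite action space $A$, horizon $H$, known deterministic rewards $r_h:S\times A\to[0,1]$ and unknown nominal transition kernels $P^o_{h,s,a}\in\Delta(S)$, $h\in\{1,\dots,H\}$. For $\rho>0$ and $Q\in\Delta(S)$ let $B_\rho(Q)=\{P\in\Delta(S):\sum_{s'}(P(s')-Q(s'))^2/Q(s')\le\rho\}$ (with $0/0=0$ and $x/0=\infty$ for $x>0$), and let the uncertainty set be $\mathcal P=\prod_{h,s,a}B_\rho(P^o_{h,s,a})$. For a deterministic Markov policy $\pi=(\pi_h)_{h=1}^H$ let $V_h^{\pi}(s)=\inf_{P\in\mathcal P}\mathbb E_{\pi,P}\big[\sum_{t=h}^H r_t(s_t,a_t)\mid s_h=s\big]$, and let $V^*_h(s)=\sup_\pi V^\pi_h(s)$, the supremum being over all deterministic Markov policies. The Robust Phased Value Learning (RPVL) algorithm draws, for every $(h,s,a)$, $N$ next-state samples from $P^o_{h,s,a}$, all samples being independent, so that $N_{\mathrm{total}}=N|S||A|H$ samples are used. It forms the empirical distributions $\widehat P^o_{h,s,a}$, sets $\widehat V_{H+1}=0$, and for $h=H,\dots,1$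 computes $$\widehat V_h(s)=\max_{a}\Big(r_h(s,a)+\inf_{P\in B_\rho(\widehat P^o_{h,s,a})}\sum_{s'}P(s')\widehat V_{h+1}(s')\Big),$$ and returns $\hat\pi=(\hat\pi_h)_{h=1}^H$, where $\hat\pi_h(s)$ is an action attaining this maximum. Theorem. Let $\delta\in(0,1)$, $\rho>0$, $\epsilon\in(0,8H)$, $C_\rho=\sqrt{1+\rho}$, and suppose $$N_{\mathrm{total}}\ \ge\ \frac{128\,C_\rho^4H^5|S||A|}{(C_\rho-1)^2\epsilon^2}\cdot\log\frac{2H|S||A|\Big(1+\frac{8C_\rho H^2}{\epsilon(C_\rho-1)}\Big)}{\delta}.$$ Then, with probability at least $1-\delta$, $\max_{1\le h\le H}\max_{s\in S}|V^*_h(s)-V^{\hat\pi}_h(s)|\le\epsilon$, however ties in the maxima are broken. -/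

import Mathlib

open MeasureTheory ProbabilityTheory
open scoped ENNReal

namespace RobustMDP

noncomputable section

/-- The expectation `P V` of the real vector `V` under the probability vector `P`. -/
def expect {S : Type*} [Fintype S] (P V : S → ℝ) : ℝ := ∑ s, P s * V s

/-- The chi-square distance `∑ (P s - Q s)² / Q s` of two probability vectors, with the usual
conventions `0 / 0 = 0` and `x / 0 = ∞` for `x > 0` (it is an `f`-divergence: a finite distance
forces `P` to vanish wherever `Q` does). -/
def chiSqDist {S : Type*} [Fintype S] (P Q : S → ℝ) : ℝ≥0∞ :=
  ∑ s, ENNReal.ofReal ((P s - Q s) ^ 2) / ENNReal.ofReal (Q s)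

/-- The ball of radius `ρ` around `Q` in the probability simplex, for the chi-square distance. -/
def chiSqBall {S : Type*} [Fintype S] (ρ : ℝ) (Q : S → ℝ) : Set (S → ℝ) :=
  {P | P ∈ stdSimplex ℝ S ∧ chiSqDist P Q ≤ ENNReal.ofReal ρ}

/-- `worst U V = inf {P V : P ∈ U}`. -/
def worst {S : Type*} [Fintype S] (U : Set (S → ℝ)) (V : S → ℝ) : ℝ :=
  sInf ((fun P => expect P V) '' U)

/-- The (rectangular) uncertainty set: all models `P` such that every `P h s a` lies in the
chi-square ball of radius `ρ` around the nominal `P₀ h s a`. -/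
def uncertaintySet {S A : Type*} [Fintype S] {H : ℕ} (ρ : ℝ) (P₀ : Fin H → S → A → S → ℝ) :
    Set (Fin H → S → A → S → ℝ) :=
  {P | ∀ h s a, P h s a ∈ chiSqBall ρ (P₀ h s a)}

/-- Probability of the state trajectory `x 0, x 1, …` at the times `h, h + 1, …, H`, given its
first state, when the deterministic Markov policy `π` is followed in the model `P`.
Times are numbered from `0`: decisions are taken at the times `0, …, H - 1`. -/
def trajProb {S A : Type*} {H : ℕ} (P : Fin H → S → A → S → ℝ) (π : Fin H → S → A) (h : Fin H)
    (x : Fin (H - h + 1) → S) : ℝ :=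
  ∏ k : Fin (H - h),
    P ⟨h + k, by omega⟩ (x k.castSucc) (π ⟨h + k, by omega⟩ (x k.castSucc)) (x k.succ)

/-- Total reward collected along a trajectory from time `h` on. -/
def trajReward {S A : Type*} {H : ℕ} (r : Fin H → S → A → ℝ) (π : Fin H → S → A) (h : Fin H)
    (x : Fin (H - h + 1) → S) : ℝ :=
  ∑ k : Fin (H - h), r ⟨h + k, by omega⟩ (x k.castSucc) (π ⟨h + k, by omega⟩ (x k.castSucc))

/-- The value of the policy `π` in the model `P`: the expected total reward from time `h` on,
given that the state at time `h` is `s`. -/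
def value {S A : Type*} [Fintype S] {H : ℕ} (r : Fin H → S → A → ℝ) (P : Fin H → S → A → S → ℝ)
    (π : Fin H → S → A) (h : Fin H) (s : S) : ℝ :=
  ∑ y : Fin (H - h) → S,
    trajProb P π h (Fin.cons s y : Fin (H - h + 1) → S) *
      trajReward r π h (Fin.cons s y : Fin (H - h + 1) → S)

/-- The robust value of the policy `π`: the infimum of its values over the uncertainty set. -/
def robustValue {S A : Type*} [Fintype S] {H : ℕ} (r : Fin H → S → A → ℝ) (ρ : ℝ)
    (P₀ : Fin H → S → A → S → ℝ) (π : Fin H → S → A) (h : Fin H) (s : S) : ℝ :=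
  ⨅ P : uncertaintySet ρ P₀, value r P.1 π h s

/-- The optimal robust value: the supremum over the deterministic Markov policies. -/
def optRobustValue {S A : Type*} [Fintype S] {H : ℕ} (r : Fin H → S → A → ℝ) (ρ : ℝ)
    (P₀ : Fin H → S → A → S → ℝ) (h : Fin H) (s : S) : ℝ :=
  ⨆ π : Fin H → S → A, robustValue r ρ P₀ π h s

/-- The maximum likelihood estimate from `N` samples per `(h, s, a)`: the empirical frequencies
of the next states. -/
def empirical {S A : Type*} [DecidableEq S] {H N : ℕ} (x : Fin H → S → A → Fin N → S) :
    Fin H → S → A → S → ℝ :=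
  fun h s a s' => ((Finset.univ.filter fun i => x h s a i = s').card : ℝ) / N

/-- `r h s a + inf {P V : P ∈ ball around Q h s a}`. -/
def robustQ {S A : Type*} [Fintype S] {H : ℕ} (r : Fin H → S → A → ℝ) (ρ : ℝ)
    (Q : Fin H → S → A → S → ℝ) (V : S → ℝ) (h : Fin H) (s : S) (a : A) : ℝ :=
  r h s a + worst (chiSqBall ρ (Q h s a)) V

/-- The value functions computed by robust dynamic programming around the estimate `Q`:
`0` at the final time `H`, and backwards `V h s = max_a (r h s a + inf {P V(h+1)})`. -/
def rpvlValue {S A : Type*} [Fintype S] {H : ℕ} (r : Fin H → S → A → ℝ) (ρ : ℝ)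
    (Q : Fin H → S → A → S → ℝ) : Fin (H + 1) → S → ℝ :=
  Fin.reverseInduction (motive := fun _ => S → ℝ) (fun _ => 0)
    (fun h V s => ⨆ a : A, robustQ r ρ Q V h s a)

/-- `π` is an output of the Robust Phased Value Learning algorithm run with radius `ρ` on the
sampled next states `x`: at every time and state it picks an action that attains the maximum
(ties may be broken in any way). -/
def IsRPVLOutput {S A : Type*} [Fintype S] [DecidableEq S] {H N : ℕ} (r : Fin H → S → A → ℝ)
    (ρ : ℝ) (x : Fin H → S → A → Fin N → S) (π : Fin H → S → A) : Prop :=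
  ∀ h s a, robustQ r ρ (empirical x) (rpvlValue r ρ (empirical x) h.succ) h s a ≤
    robustQ r ρ (empirical x) (rpvlValue r ρ (empirical x) h.succ) h s (π h s)

/-- `X h s a i` (`i < N`) are the samples of a generative model with transition probabilities
`P₀`: all of them are independent, and `X h s a i` has the law `P₀ h s a`. -/
structure IsGenerativeSample {S A Ω : Type*} [MeasurableSpace S] [MeasurableSpace Ω] {H N : ℕ}
    (μ : Measure Ω) (P₀ : Fin H → S → A → S → ℝ) (X : Fin H → S → A → Fin N → Ω → S) : Prop where
  measurable : ∀ h s a i, Measurable (X h s a i)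
  indep : iIndepFun (fun j : Fin H × S × A × Fin N => X j.1 j.2.1 j.2.2.1 j.2.2.2) μ
  law : ∀ h s a i s', μ.real {ω | X h s a i ω = s'} = P₀ h s a s'

end

end RobustMDP

namespace RobustMDP

/-! The value functions satisfy backward recursions, so it suffices to control, at each stage, the
gap between the worst-case expectations over the nominal and the empirical ball, evaluated at the
computed value function of the next stage. If every gap is at most `e`, the robust value of the
greedy policy and the optimal robust value both lie within `H e` of the computed value
(`abs_optRobustValue_sub_le`).

The gap is handled by convex duality: with `C = √(1 + ρ)`, the worst-case expectation is the maximum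
over `η` of `η - C √(E_Q (η - V)₊²)`, attained in `[0, C H / (C - 1)]` (`dualObj_le_expect`,
`exists_dual`). The ball has disappeared, and only square roots of second moments at points `η` of a
finite grid need comparing (`worst_le_worst_add`).

A Chernoff bound for the square root of an empirical mean has the variance-free form `2 exp (-N τ²)`
(`measureReal_abs_sqrt_mean_sub_le`). The function `V` is random, but it is computed from the
samples of later stages, which are independent of those of the current one. It can therefore be
frozen, with no covering of the space of value functions
(`measureReal_abs_sqrt_shortfall_rpvlValue_sub_le`). A union bound over stages, states, actions and
grid points concludes. -/

/-! ### Convex duality for the chi-square ball -/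

/-- A real-valued description of the chi-square ball. -/
lemma mem_chiSqBall_iff {S : Type*} [Fintype S] {ρ : ℝ} (hρ : 0 ≤ ρ) {P Q : S → ℝ}
    (hQ : Q ∈ stdSimplex ℝ S) :
    P ∈ chiSqBall ρ Q ↔ P ∈ stdSimplex ℝ S ∧ (∀ s, Q s = 0 → P s = 0) ∧
      ∑ s, P s ^ 2 / Q s ≤ 1 + ρ := by
  unfold chiSqBall
  simp only [Set.mem_ofPred_eq]
  refine and_congr_right fun hP => ?_
  -- Real division by zero gives `0` instead of `∞`, so the support condition has to be carried
  -- separately.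
  have key : (∀ s, Q s = 0 → P s = 0) →
      chiSqDist P Q = ENNReal.ofReal (∑ s, P s ^ 2 / Q s - 1) := by
    intro h0
    have h1 : ∑ s, P s ^ 2 / Q s - 1 = ∑ s, (P s - Q s) ^ 2 / Q s := by
      have : ∀ s, (P s - Q s) ^ 2 / Q s = P s ^ 2 / Q s - 2 * P s + Q s := by
        intro s
        by_cases hs : Q s = 0
        · simp [hs, h0 s hs]
        · field_simp
          ring
      simp_rw [this, Finset.sum_add_distrib, Finset.sum_sub_distrib, ← Finset.mul_sum]
      rw [hP.2, hQ.2]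
      ring
    rw [h1, ENNReal.ofReal_sum_of_nonneg fun s _ => div_nonneg (sq_nonneg _) (hQ.1 s)]
    refine Finset.sum_congr rfl fun s _ => ?_
    by_cases hs : Q s = 0
    · simp [hs, h0 s hs]
    · rw [ENNReal.ofReal_div_of_pos (lt_of_le_of_ne (hQ.1 s) (Ne.symm hs))]
  constructor
  · intro h
    have h0 : ∀ s, Q s = 0 → P s = 0 := by
      intro s hs
      by_contra hne
      have : chiSqDist P Q = ⊤ := by
        refine ENNReal.sum_eq_top.2 ⟨s, Finset.mem_univ s, ?_⟩
        rw [hs, ENNReal.ofReal_zero, ENNReal.div_zero]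
        simp only [sub_zero, ne_eq, ENNReal.ofReal_eq_zero, not_le]
        positivity
      rw [this] at h
      exact absurd (top_le_iff.1 h) ENNReal.ofReal_ne_top
    refine ⟨h0, ?_⟩
    rw [key h0, ENNReal.ofReal_le_ofReal_iff hρ] at h
    linarith
  · rintro ⟨h0, h⟩
    rw [key h0]
    exact ENNReal.ofReal_le_ofReal (by linarith)

lemma self_mem_chiSqBall {S : Type*} [Fintype S] {ρ : ℝ} {Q : S → ℝ}
    (hQ : Q ∈ stdSimplex ℝ S) : Q ∈ chiSqBall ρ Q := by
  refine ⟨hQ, ?_⟩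
  simp [chiSqDist]

lemma expect_mem_Icc {S : Type*} [Fintype S] {P V : S → ℝ} {b : ℝ} (hP : P ∈ stdSimplex ℝ S)
    (hV : ∀ s, V s ∈ Set.Icc 0 b) : expect P V ∈ Set.Icc 0 b := by
  refine ⟨Finset.sum_nonneg fun s _ => mul_nonneg (hP.1 s) (hV s).1, ?_⟩
  calc expect P V ≤ ∑ s, P s * b :=
        Finset.sum_le_sum fun s _ => mul_le_mul_of_nonneg_left (hV s).2 (hP.1 s)
    _ = b := by rw [← Finset.sum_mul, hP.2, one_mul]

/-- The second moment of the shortfall `(η - V)₊` under `Q`. -/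
noncomputable def shortfallSq {S : Type*} [Fintype S] (Q V : S → ℝ) (η : ℝ) : ℝ :=
  ∑ s, Q s * (max (η - V s) 0) ^ 2

/-- The objective of the dual problem for the chi-square ball, where `C = √(1 + ρ)`. -/
noncomputable def dualObj {S : Type*} [Fintype S] (C : ℝ) (Q V : S → ℝ) (η : ℝ) : ℝ :=
  η - C * √(shortfallSq Q V η)

lemma shortfallSq_nonneg {S : Type*} [Fintype S] {Q V : S → ℝ} (hQ : Q ∈ stdSimplex ℝ S) (η : ℝ) :
    0 ≤ shortfallSq Q V η :=
  Finset.sum_nonneg fun s _ => mul_nonneg (hQ.1 s) (sq_nonneg _)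

lemma shortfallSq_mono {S : Type*} [Fintype S] {Q V : S → ℝ} (hQ : Q ∈ stdSimplex ℝ S) :
    Monotone (shortfallSq Q V) := by
  intro η η' h
  refine Finset.sum_le_sum fun s _ => mul_le_mul_of_nonneg_left ?_ (hQ.1 s)
  gcongr

/-- Weak duality. -/
lemma dualObj_le_expect {S : Type*} [Fintype S] {ρ : ℝ} (hρ : 0 ≤ ρ) {P Q : S → ℝ}
    (hQ : Q ∈ stdSimplex ℝ S) (hP : P ∈ chiSqBall ρ Q) (V : S → ℝ) (η : ℝ) :
    dualObj (√(1 + ρ)) Q V η ≤ expect P V := by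
  obtain ⟨hPs, h0, hle⟩ := (mem_chiSqBall_iff hρ hQ).1 hP
  -- Cauchy–Schwarz for the factors `P / √Q` and `√Q (η - V)₊`.
  have cs : (∑ s, P s * max (η - V s) 0) ^ 2 ≤ (∑ s, P s ^ 2 / Q s) * shortfallSq Q V η := by
    refine Finset.sum_sq_le_sum_mul_sum_of_sq_le_mul _
      (fun s _ => div_nonneg (sq_nonneg _) (hQ.1 s))
      (fun s _ => mul_nonneg (hQ.1 s) (sq_nonneg _)) fun s _ => le_of_eq ?_
    by_cases hs : Q s = 0
    · simp [hs, h0 s hs]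
    · field_simp
  have h1 : ∑ s, P s * max (η - V s) 0 ≤ √(1 + ρ) * √(shortfallSq Q V η) := by
    rw [← Real.sqrt_mul (by linarith)]
    exact Real.le_sqrt_of_sq_le
      (cs.trans (mul_le_mul_of_nonneg_right hle (shortfallSq_nonneg hQ η)))
  have h2 : η - expect P V ≤ ∑ s, P s * max (η - V s) 0 := by
    have : η - expect P V = ∑ s, P s * (η - V s) := by
      simp_rw [mul_sub, Finset.sum_sub_distrib, ← Finset.sum_mul, hPs.2, one_mul, expect]
    rw [this]
    exact Finset.sum_le_sum fun s _ => mul_le_mul_of_nonneg_left (le_max_left _ _) (hPs.1 s)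
  unfold dualObj
  linarith

/-- A maximizer of the dual objective lies below `C b / (C - 1)`. -/
lemma le_of_dualObj_nonneg {S : Type*} [Fintype S] {C b : ℝ} (hC : 1 < C) {Q V : S → ℝ}
    (hQ : Q ∈ stdSimplex ℝ S) (hb : 0 ≤ b) (hV : ∀ s, V s ∈ Set.Icc 0 b) {η : ℝ}
    (h : 0 ≤ dualObj C Q V η) : η ≤ C * b / (C - 1) := by
  rw [le_div_iff₀ (by linarith)]
  rcases le_total η b with hη | hη
  · nlinarith
  -- Above `b` the shortfall is at least `η - b` at every state, so the dual objective is at most `η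
  -- - C (η - b)`.
  · have : η - b ≤ √(shortfallSq Q V η) := by
      refine Real.le_sqrt_of_sq_le ?_
      calc (η - b) ^ 2 = ∑ s, Q s * (η - b) ^ 2 := by rw [← Finset.sum_mul, hQ.2, one_mul]
        _ ≤ _ := by
          refine Finset.sum_le_sum fun s _ => mul_le_mul_of_nonneg_left ?_ (hQ.1 s)
          have := (hV s).2
          refine pow_le_pow_left₀ (by linarith) (le_max_of_le_left (by linarith)) 2
    unfold dualObj at h
    nlinarith

/-- If the conditional distribution of `Q` on the minimizers of `V` is admissible, it attains the
dual objective at the minimum. -/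
lemma exists_dual_of_min {S : Type*} [Fintype S] {ρ : ℝ} (hρ : 0 ≤ ρ) {Q V : S → ℝ}
    (hQ : Q ∈ stdSimplex ℝ S) {s₀ : S} (hs₀ : 0 < Q s₀) (hmin : ∀ s, 0 < Q s → V s₀ ≤ V s)
    {η₁ : ℝ} (hη₁ : V s₀ < η₁) (hgap : ∀ s, 0 < Q s → V s ≠ V s₀ → η₁ ≤ V s)
    (h : √(shortfallSq Q V η₁) ≤ √(1 + ρ) * ∑ s, Q s * max (η₁ - V s) 0) :
    ∃ P ∈ chiSqBall ρ Q, expect P V ≤ dualObj (√(1 + ρ)) Q V (V s₀) := by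
  classical
  set q := ∑ s, if V s = V s₀ then Q s else 0 with hq
  have hqpos : 0 < q := by
    have : (if V s₀ = V s₀ then Q s₀ else 0) ≤ q :=
      Finset.single_le_sum (f := fun s => if V s = V s₀ then Q s else 0)
        (fun s _ => by split_ifs <;> simp [hQ.1 s]) (Finset.mem_univ s₀)
    simp only [if_true] at this
    linarith
  -- No value of `V` on the support lies strictly between `V s₀` and `η₁`, so only the minimizers
  -- contribute to the moments at `η₁`.
  have e1 : ∀ s, Q s * max (η₁ - V s) 0 = (if V s = V s₀ then Q s else 0) * (η₁ - V s₀) := by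
    intro s
    rcases (hQ.1 s).eq_or_lt with h0 | hpos
    · simp [← h0]
    · split_ifs with hs
      · rw [hs, max_eq_left (by linarith)]
      · rw [max_eq_right (by linarith [hgap s hpos hs])]
        simp
  have e2 : ∀ s, Q s * max (η₁ - V s) 0 ^ 2 =
      (if V s = V s₀ then Q s else 0) * (η₁ - V s₀) ^ 2 := by
    intro s
    rcases (hQ.1 s).eq_or_lt with h0 | hpos
    · simp [← h0]
    · split_ifs with hs
      · rw [hs, max_eq_left (by linarith)]
      · rw [max_eq_right (by linarith [hgap s hpos hs])]
        simp
  -- After cancelling `η₁ - V s₀` the hypothesis reads `√q ≤ C q`. The conditional distribution has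
  -- `∑ P² / Q = 1 / q`, so this is exactly its admissibility.
  have hq1 : 1 ≤ (1 + ρ) * q := by
    unfold shortfallSq at h
    simp_rw [e1, e2, ← Finset.sum_mul, ← hq] at h
    have h2 := pow_le_pow_left₀ (Real.sqrt_nonneg _) h 2
    rw [Real.sq_sqrt (by positivity), mul_pow, Real.sq_sqrt (by linarith)] at h2
    have h3 : 0 < q * (η₁ - V s₀) ^ 2 := mul_pos hqpos (pow_pos (by linarith) 2)
    by_contra hcon
    push Not at hcon
    nlinarith
  refine ⟨fun s => (if V s = V s₀ then Q s else 0) / q, ?_, ?_⟩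
  · refine (mem_chiSqBall_iff hρ hQ).2 ⟨⟨fun s => ?_, ?_⟩, fun s hs => ?_, ?_⟩
    · exact div_nonneg (by split_ifs <;> simp [hQ.1 s]) hqpos.le
    · rw [← Finset.sum_div, div_self hqpos.ne']
    · simp [hs]
    · have : ∀ s, ((if V s = V s₀ then Q s else 0) / q) ^ 2 / Q s =
          (if V s = V s₀ then Q s else 0) / q ^ 2 := by
        intro s
        split_ifs
        · by_cases h0 : Q s = 0
          · simp [h0]
          · field_simp
        · simp
      simp_rw [this]
      rw [← Finset.sum_div, ← hq, div_le_iff₀ (by positivity)]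
      nlinarith
  · have h1 : expect (fun s => (if V s = V s₀ then Q s else 0) / q) V = V s₀ := by
      have : ∀ s, (if V s = V s₀ then Q s else 0) / q * V s =
          (if V s = V s₀ then Q s else 0) * (V s₀ / q) := by
        intro s
        split_ifs with hs
        · rw [hs]; ring
        · simp
      simp_rw [expect, this]
      rw [← Finset.sum_mul, ← hq]
      field_simp
    have h2 : shortfallSq Q V (V s₀) = 0 := by
      refine Finset.sum_eq_zero fun s _ => ?_
      rcases (hQ.1 s).eq_or_lt with h0 | hpos
      · simp [← h0]
      · rw [max_eq_right (by linarith [hmin s hpos])]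
        simp
    rw [h1, dualObj, h2]
    simp

/-- If `η` satisfies the first order condition of the dual problem, the distribution proportional
to `Q (η - V)₊` is admissible and attains the dual objective at `η`. -/
lemma exists_dual_of_stationary {S : Type*} [Fintype S] {ρ : ℝ} (hρ : 0 ≤ ρ) {Q V : S → ℝ}
    (hQ : Q ∈ stdSimplex ℝ S) {η : ℝ} (hpos : 0 < ∑ s, Q s * max (η - V s) 0)
    (h : √(shortfallSq Q V η) = √(1 + ρ) * ∑ s, Q s * max (η - V s) 0) :
    ∃ P ∈ chiSqBall ρ Q, expect P V ≤ dualObj (√(1 + ρ)) Q V η := by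
  set m := ∑ s, Q s * max (η - V s) 0 with hm
  have h2 : shortfallSq Q V η = (1 + ρ) * m ^ 2 := by
    rw [← Real.sq_sqrt (shortfallSq_nonneg (V := V) hQ η), h, mul_pow,
      Real.sq_sqrt (by linarith)]
  refine ⟨fun s => Q s * max (η - V s) 0 / m, ?_, ?_⟩
  · refine (mem_chiSqBall_iff hρ hQ).2 ⟨⟨fun s => ?_, ?_⟩, fun s hs => ?_, ?_⟩
    · exact div_nonneg (mul_nonneg (hQ.1 s) (le_max_right _ _)) hpos.le
    · rw [← Finset.sum_div, div_self hpos.ne']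
    · simp [hs]
    · have : ∀ s, (Q s * max (η - V s) 0 / m) ^ 2 / Q s = Q s * max (η - V s) 0 ^ 2 / m ^ 2 := by
        intro s
        by_cases h0 : Q s = 0
        · simp [h0]
        · field_simp
      simp_rw [this]
      rw [← Finset.sum_div, div_le_iff₀ (by positivity)]
      exact h2.le
  · have : ∀ s, Q s * max (η - V s) 0 / m * V s =
        η / m * (Q s * max (η - V s) 0) - Q s * max (η - V s) 0 ^ 2 / m := by
      intro s
      rcases le_total (η - V s) 0 with hs | hs
      · simp [max_eq_right hs]
      · rw [max_eq_left hs]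
        field_simp
        ring
    simp_rw [expect, this, Finset.sum_sub_distrib, ← Finset.mul_sum, ← Finset.sum_div, ← hm]
    rw [show ∑ s, Q s * max (η - V s) 0 ^ 2 = (1 + ρ) * m ^ 2 from h2, dualObj, h,
      ← mul_assoc, Real.mul_self_sqrt (by linarith)]
    field_simp
    exact le_rfl

/-- Strong duality: some point of the chi-square ball attains the dual objective, at a dual
variable between `0` and `C b / (C - 1)`. -/
lemma exists_dual {S : Type*} [Fintype S] {ρ b : ℝ} (hρ : 0 < ρ) (hb : 0 ≤ b) {Q V : S → ℝ}
    (hQ : Q ∈ stdSimplex ℝ S) (hV : ∀ s, V s ∈ Set.Icc 0 b) :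
    ∃ P ∈ chiSqBall ρ Q, ∃ η ∈ Set.Icc 0 (√(1 + ρ) * b / (√(1 + ρ) - 1)),
      expect P V ≤ dualObj (√(1 + ρ)) Q V η := by
  classical
  have hC : 1 < √(1 + ρ) := Real.lt_sqrt_of_sq_lt (by linarith)
  obtain ⟨P, hP, η, hη, hle⟩ : ∃ P ∈ chiSqBall ρ Q, ∃ η, 0 ≤ η ∧
      expect P V ≤ dualObj (√(1 + ρ)) Q V η := by
    set supp := Finset.univ.filter fun s => 0 < Q s with hsupp
    have hne : supp.Nonempty := by
      by_contra hcon
      rw [Finset.not_nonempty_iff_eq_empty, Finset.filter_eq_empty_iff] at hcon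
      have : ∑ s, Q s = 0 := Finset.sum_eq_zero fun s hs =>
        le_antisymm (not_lt.1 (hcon hs)) (hQ.1 s)
      rw [hQ.2] at this
      exact one_ne_zero this
    obtain ⟨s₀, hs₀, hmin⟩ := supp.exists_min_image V hne
    have hs₀' : 0 < Q s₀ := (Finset.mem_filter.1 hs₀).2
    have hmin' : ∀ s, 0 < Q s → V s₀ ≤ V s := fun s hs =>
      hmin s (Finset.mem_filter.2 ⟨Finset.mem_univ s, hs⟩)
    obtain ⟨η₁, hη₁, hgap⟩ : ∃ η₁, V s₀ < η₁ ∧ ∀ s, 0 < Q s → V s ≠ V s₀ → η₁ ≤ V s := by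
      set T := supp.filter fun s => V s ≠ V s₀ with hT
      rcases T.eq_empty_or_nonempty with hTe | hTn
      · refine ⟨V s₀ + 1, by linarith, fun s hs hne' => ?_⟩
        exact absurd hne' (Finset.filter_eq_empty_iff.1 hTe
          (Finset.mem_filter.2 ⟨Finset.mem_univ s, hs⟩))
      · obtain ⟨s₁, hs₁, hmin₁⟩ := T.exists_min_image V hTn
        obtain ⟨h1, h2⟩ := Finset.mem_filter.1 hs₁
        refine ⟨V s₁, lt_of_le_of_ne (hmin s₁ h1) (Ne.symm h2), fun s hs hne' => hmin₁ s ?_⟩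
        exact Finset.mem_filter.2 ⟨Finset.mem_filter.2 ⟨Finset.mem_univ s, hs⟩, hne'⟩
    -- Where the shortfall moment is positive, `F` has the sign of minus the derivative of the dual
    -- objective. Either the objective has stopped increasing at `η₁`, and `V s₀` serves as dual
    -- variable, or a zero of `F` beyond `η₁` does.
    set F : ℝ → ℝ := fun η =>
      √(1 + ρ) * ∑ s, Q s * max (η - V s) 0 - √(shortfallSq Q V η) with hF
    by_cases hcase : 0 ≤ F η₁
    · obtain ⟨P, hP, hle⟩ := exists_dual_of_min hρ.le hQ hs₀' hmin' hη₁ hgap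
        (by simpa [hF] using hcase)
      exact ⟨P, hP, V s₀, (hV s₀).1, hle⟩
    · push Not at hcase
      have hFc : Continuous F := by
        simp only [hF, shortfallSq]
        fun_prop
      -- Far out, `F η ≥ C (η - b) - η`, which is nonnegative as soon as `η ≥ C b / (C - 1)`.
      obtain ⟨η₂, h12, hF2⟩ : ∃ η₂, η₁ ≤ η₂ ∧ 0 ≤ F η₂ := by
        refine ⟨max η₁ (√(1 + ρ) * b / (√(1 + ρ) - 1)), le_max_left _ _, ?_⟩
        set η₂ := max η₁ (√(1 + ρ) * b / (√(1 + ρ) - 1))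
        have hη₂ : √(1 + ρ) * b / (√(1 + ρ) - 1) ≤ η₂ := le_max_right _ _
        rw [div_le_iff₀ (by linarith)] at hη₂
        have hbη : 0 ≤ η₂ := by
          have := (hV s₀).1
          have := le_max_left η₁ (√(1 + ρ) * b / (√(1 + ρ) - 1))
          change η₁ ≤ η₂ at this
          linarith
        have h1 : √(shortfallSq Q V η₂) ≤ η₂ := by
          refine Real.sqrt_le_iff.2 ⟨hbη, ?_⟩
          calc shortfallSq Q V η₂ ≤ ∑ s, Q s * η₂ ^ 2 := by
                refine Finset.sum_le_sum fun s _ => mul_le_mul_of_nonneg_left ?_ (hQ.1 s)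
                refine pow_le_pow_left₀ (le_max_right _ _) (max_le ?_ hbη) 2
                linarith [(hV s).1]
            _ = η₂ ^ 2 := by rw [← Finset.sum_mul, hQ.2, one_mul]
        have h2 : η₂ - b ≤ ∑ s, Q s * max (η₂ - V s) 0 := by
          calc η₂ - b = ∑ s, Q s * (η₂ - b) := by rw [← Finset.sum_mul, hQ.2, one_mul]
            _ ≤ _ := by
              refine Finset.sum_le_sum fun s _ => mul_le_mul_of_nonneg_left ?_ (hQ.1 s)
              exact le_max_of_le_left (by linarith [(hV s).2])
        have h3 : √(1 + ρ) * (η₂ - b) ≤ √(1 + ρ) * ∑ s, Q s * max (η₂ - V s) 0 :=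
          mul_le_mul_of_nonneg_left h2 (by linarith)
        simp only [hF]
        nlinarith
      obtain ⟨η, hη, hη0⟩ := intermediate_value_Icc h12 hFc.continuousOn
        (Set.mem_Icc.2 ⟨hcase.le, hF2⟩)
      have hpos : 0 < ∑ s, Q s * max (η - V s) 0 := by
        refine Finset.sum_pos' (fun s _ => mul_nonneg (hQ.1 s) (le_max_right _ _))
          ⟨s₀, Finset.mem_univ _, mul_pos hs₀' (lt_max_of_lt_left ?_)⟩
        linarith [hη.1]
      obtain ⟨P, hP, hle⟩ := exists_dual_of_stationary hρ.le hQ hpos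
        (by simp only [hF] at hη0; linarith)
      exact ⟨P, hP, η, by linarith [hη.1, (hV s₀).1], hle⟩
  refine ⟨P, hP, η, ⟨hη, le_of_dualObj_nonneg hC hQ hb hV ?_⟩, hle⟩
  exact (expect_mem_Icc hP.1 hV).1.trans hle

lemma bddBelow_expect_image {S : Type*} [Fintype S] {ρ b : ℝ} {Q V : S → ℝ}
    (hV : ∀ s, V s ∈ Set.Icc 0 b) : BddBelow ((fun P => expect P V) '' chiSqBall ρ Q) :=
  ⟨0, by rintro _ ⟨P, hP, rfl⟩; exact (expect_mem_Icc hP.1 hV).1⟩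

lemma worst_le_expect {S : Type*} [Fintype S] {ρ b : ℝ} {P Q V : S → ℝ}
    (hP : P ∈ chiSqBall ρ Q) (hV : ∀ s, V s ∈ Set.Icc 0 b) :
    worst (chiSqBall ρ Q) V ≤ expect P V :=
  csInf_le (bddBelow_expect_image hV) ⟨P, hP, rfl⟩

lemma le_worst {S : Type*} [Fintype S] {ρ : ℝ} {Q V : S → ℝ} (hQ : Q ∈ stdSimplex ℝ S) {c : ℝ}
    (h : ∀ P ∈ chiSqBall ρ Q, c ≤ expect P V) : c ≤ worst (chiSqBall ρ Q) V :=
  le_csInf ⟨_, Q, self_mem_chiSqBall hQ, rfl⟩ (by rintro _ ⟨P, hP, rfl⟩; exact h P hP)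

lemma worst_mem_Icc {S : Type*} [Fintype S] {ρ b : ℝ} {Q V : S → ℝ} (hQ : Q ∈ stdSimplex ℝ S)
    (hV : ∀ s, V s ∈ Set.Icc 0 b) : worst (chiSqBall ρ Q) V ∈ Set.Icc 0 b :=
  ⟨le_worst hQ fun _ hP => (expect_mem_Icc hP.1 hV).1,
    (worst_le_expect (self_mem_chiSqBall hQ) hV).trans (expect_mem_Icc hQ hV).2⟩

/-- The dual certificate bounds every expectation over the ball from below. Attainment lets a worst
kernel be selected for each stage, state and action. -/
lemma exists_expect_eq_worst {S : Type*} [Fintype S] {ρ b : ℝ} (hρ : 0 < ρ) (hb : 0 ≤ b)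
    {Q V : S → ℝ} (hQ : Q ∈ stdSimplex ℝ S) (hV : ∀ s, V s ∈ Set.Icc 0 b) :
    ∃ P ∈ chiSqBall ρ Q, expect P V = worst (chiSqBall ρ Q) V := by
  obtain ⟨P, hP, η, -, hle⟩ := exists_dual hρ hb hQ hV
  exact ⟨P, hP, le_antisymm
    (hle.trans (le_worst hQ fun P' hP' => dualObj_le_expect hρ.le hQ hP' V η))
    (worst_le_expect hP hV)⟩

/-- Worst-case expectations around two centres are close if the square roots of the shortfall
moments are close on a grid of mesh `θ`. -/
lemma worst_le_worst_add {S : Type*} [Fintype S] {ρ b θ τ : ℝ} (hρ : 0 < ρ) (hb : 0 ≤ b)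
    (hθ : 0 < θ) {Q Q' V : S → ℝ} (hQ : Q ∈ stdSimplex ℝ S) (hQ' : Q' ∈ stdSimplex ℝ S)
    (hV : ∀ s, V s ∈ Set.Icc 0 b)
    (h : ∀ k : ℕ, k * θ ≤ √(1 + ρ) * b / (√(1 + ρ) - 1) →
      √(shortfallSq Q' V (k * θ)) ≤ √(shortfallSq Q V (k * θ)) + τ) :
    worst (chiSqBall ρ Q) V ≤ worst (chiSqBall ρ Q') V + (√(1 + ρ) * τ + θ) := by
  obtain ⟨P, hP, η, hη, hle⟩ := exists_dual hρ hb hQ hV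
  have h1 := (worst_le_expect hP hV).trans hle
  set k := ⌊η / θ⌋₊
  have hk1 : k * θ ≤ η := by
    rw [← le_div_iff₀ hθ]
    exact Nat.floor_le (div_nonneg hη.1 hθ.le)
  have hk2 : η ≤ k * θ + θ := by
    have := (Nat.lt_floor_add_one (η / θ)).le
    rw [div_le_iff₀ hθ] at this
    linarith
  have h2 : dualObj (√(1 + ρ)) Q' V (k * θ) ≤ worst (chiSqBall ρ Q') V :=
    le_worst hQ' fun P' hP' => dualObj_le_expect hρ.le hQ' hP' V _
  have h3 := mul_le_mul_of_nonneg_left (h k (hk1.trans hη.2)) (Real.sqrt_nonneg (1 + ρ))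
  -- Rounding `η` down can only decrease the shortfall moment, so the rounding costs `θ` in the
  -- linear term and nothing in the square root.
  have h4 := mul_le_mul_of_nonneg_left (Real.sqrt_le_sqrt (shortfallSq_mono (V := V) hQ hk1))
    (Real.sqrt_nonneg (1 + ρ))
  unfold dualObj at h1 h2
  linarith

/-! ### Trajectory sums and the Bellman recursion -/

/-- Expected total reward over `n` steps from the state `s`, in the inhomogeneous Markov chain with
transition matrices `p k` and rewards `R k`. -/
noncomputable def pathValue {S : Type*} [Fintype S] (n : ℕ) (p : ℕ → S → S → ℝ) (R : ℕ → S → ℝ)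
    (s : S) : ℝ :=
  ∑ y : Fin n → S,
    (∏ k : Fin n, p k ((Fin.cons s y : Fin (n + 1) → S) k.castSucc)
      ((Fin.cons s y : Fin (n + 1) → S) k.succ)) *
      ∑ k : Fin n, R k ((Fin.cons s y : Fin (n + 1) → S) k.castSucc)

lemma sum_fin_succ_arrow {S : Type*} [Fintype S] {n : ℕ} (f : (Fin (n + 1) → S) → ℝ) :
    ∑ y, f y = ∑ s, ∑ z : Fin n → S, f (Fin.cons s z) := by
  rw [← (Fin.consEquiv fun _ : Fin (n + 1) => S).sum_comp, Fintype.sum_prod_type]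
  rfl

lemma prod_path_succ {S : Type*} {n : ℕ} (p : ℕ → S → S → ℝ) (s s' : S) (z : Fin n → S) :
    ∏ k : Fin (n + 1), p k ((Fin.cons s (Fin.cons s' z) : Fin (n + 2) → S) k.castSucc)
      ((Fin.cons s (Fin.cons s' z) : Fin (n + 2) → S) k.succ) =
    p 0 s s' * ∏ k : Fin n, p (k + 1) ((Fin.cons s' z : Fin (n + 1) → S) k.castSucc)
      ((Fin.cons s' z : Fin (n + 1) → S) k.succ) := by
  rw [Fin.prod_univ_succ]
  congr 1

lemma sum_path_succ {S : Type*} {n : ℕ} (R : ℕ → S → ℝ) (s s' : S) (z : Fin n → S) :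
    ∑ k : Fin (n + 1), R k ((Fin.cons s (Fin.cons s' z) : Fin (n + 2) → S) k.castSucc) =
    R 0 s + ∑ k : Fin n, R (k + 1) ((Fin.cons s' z : Fin (n + 1) → S) k.castSucc) := by
  rw [Fin.sum_univ_succ]
  congr 1

lemma sum_prod_path {S : Type*} [Fintype S] (n : ℕ) (p : ℕ → S → S → ℝ)
    (hp : ∀ k < n, ∀ s, ∑ s', p k s s' = 1) (s : S) :
    ∑ y : Fin n → S, ∏ k : Fin n, p k ((Fin.cons s y : Fin (n + 1) → S) k.castSucc)
      ((Fin.cons s y : Fin (n + 1) → S) k.succ) = 1 := by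
  induction n generalizing p s with
  | zero => simp
  | succ n ih =>
    rw [sum_fin_succ_arrow]
    simp_rw [prod_path_succ, ← Finset.mul_sum]
    simp_rw [fun s' => ih (fun k => p (k + 1)) (fun k hk => hp (k + 1) (by omega)) s', mul_one]
    exact hp 0 (by omega) s

/-- Split off the first transition. The first reward factors out because the probabilities of the
remaining trajectories sum to one. -/
lemma pathValue_succ {S : Type*} [Fintype S] (n : ℕ) (p : ℕ → S → S → ℝ) (R : ℕ → S → ℝ)
    (hp : ∀ k < n + 1, ∀ s, ∑ s', p k s s' = 1) (s : S) :
    pathValue (n + 1) p R s =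
      R 0 s + expect (p 0 s) (pathValue n (fun k => p (k + 1)) (fun k => R (k + 1))) := by
  rw [pathValue, sum_fin_succ_arrow]
  simp_rw [prod_path_succ, sum_path_succ, mul_add, Finset.sum_add_distrib, mul_assoc,
    ← Finset.mul_sum, ← Finset.sum_mul]
  simp_rw [fun s' => sum_prod_path n (fun k => p (k + 1))
    (fun k hk => hp (k + 1) (by omega)) s', one_mul, ← Finset.sum_mul, hp 0 (by omega) s, one_mul]
  rfl

/-- The transition matrix of the policy `π` at time `j`; it is `0` from the horizon on. -/
noncomputable def stepProb {S A : Type*} {H : ℕ} (P : Fin H → S → A → S → ℝ) (π : Fin H → S → A)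
    (j : ℕ) (s s' : S) : ℝ :=
  if hj : j < H then P ⟨j, hj⟩ s (π ⟨j, hj⟩ s) s' else 0

/-- The reward of the policy `π` at time `j`; it is `0` from the horizon on. -/
noncomputable def stepReward {S A : Type*} {H : ℕ} (r : Fin H → S → A → ℝ) (π : Fin H → S → A)
    (j : ℕ) (s : S) : ℝ :=
  if hj : j < H then r ⟨j, hj⟩ s (π ⟨j, hj⟩ s) else 0

/-- The expected total reward of `π` in the model `P` from time `j` on, for `n` steps. -/
noncomputable def tailValue {S A : Type*} [Fintype S] {H : ℕ} (r : Fin H → S → A → ℝ)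
    (P : Fin H → S → A → S → ℝ) (π : Fin H → S → A) (n j : ℕ) : S → ℝ :=
  pathValue n (fun k => stepProb P π (j + k)) (fun k => stepReward r π (j + k))

lemma value_eq_tailValue {S A : Type*} [Fintype S] {H : ℕ} (r : Fin H → S → A → ℝ)
    (P : Fin H → S → A → S → ℝ) (π : Fin H → S → A) (h : Fin H) (s : S) :
    value r P π h s = tailValue r P π (H - h) h s := by
  have hlt : ∀ k : Fin (H - h), (h : ℕ) + k < H := fun k => by omega
  simp only [value, tailValue, pathValue, trajProb, trajReward, stepProb, stepReward, hlt,
    dif_pos]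

lemma tailValue_succ {S A : Type*} [Fintype S] {H : ℕ} (r : Fin H → S → A → ℝ)
    {P : Fin H → S → A → S → ℝ} (hP : ∀ h s a, P h s a ∈ stdSimplex ℝ S) (π : Fin H → S → A)
    {n j : ℕ} (hj : j + (n + 1) ≤ H) (s : S) :
    tailValue r P π (n + 1) j s = r ⟨j, by omega⟩ s (π ⟨j, by omega⟩ s) +
      expect (P ⟨j, by omega⟩ s (π ⟨j, by omega⟩ s)) (tailValue r P π n (j + 1)) := by
  have hj' : j < H := by omega
  rw [tailValue, pathValue_succ]
  · simp only [add_zero, stepReward, hj', dif_pos, tailValue]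
    congr 2
    · funext s'
      simp [stepProb, hj']
    · simp_rw [add_assoc, add_comm 1]
  · intro k hk s'
    have : j + k < H := by omega
    simp only [stepProb, this, dif_pos]
    exact (hP _ _ _).2

/-! ### Robust dynamic programming and propagation of errors -/

lemma rpvlValue_last {S A : Type*} [Fintype S] {H : ℕ} (r : Fin H → S → A → ℝ) (ρ : ℝ)
    (Q : Fin H → S → A → S → ℝ) : rpvlValue r ρ Q (Fin.last H) = fun _ => 0 := by
  simp [rpvlValue]

lemma rpvlValue_castSucc {S A : Type*} [Fintype S] {H : ℕ} (r : Fin H → S → A → ℝ) (ρ : ℝ)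
    (Q : Fin H → S → A → S → ℝ) (h : Fin H) : rpvlValue r ρ Q h.castSucc =
      fun s => ⨆ a : A, robustQ r ρ Q (rpvlValue r ρ Q h.succ) h s a := by
  simp [rpvlValue]

/-- The backward recursion down to stage `j` never reads earlier kernels. This is the source of the
independence between stages. -/
lemma rpvlValue_congr {S A : Type*} [Fintype S] {H : ℕ} (r : Fin H → S → A → ℝ) (ρ : ℝ)
    {Q Q' : Fin H → S → A → S → ℝ} (j : Fin (H + 1))
    (hQ : ∀ h : Fin H, j ≤ h.castSucc → Q h = Q' h) :
    rpvlValue r ρ Q j = rpvlValue r ρ Q' j := by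
  induction j using Fin.reverseInduction with
  | last => rw [rpvlValue_last, rpvlValue_last]
  | cast h ih =>
    rw [rpvlValue_castSucc, rpvlValue_castSucc,
      ih fun h' hh' => hQ h' ((Fin.castSucc_le_succ h).trans hh')]
    funext s
    simp only [robustQ, hQ h le_rfl]

lemma rpvlValue_mem_Icc {S A : Type*} [Fintype S] [Finite A] [Nonempty A] {H : ℕ}
    {r : Fin H → S → A → ℝ} (hr : ∀ h s a, r h s a ∈ Set.Icc (0 : ℝ) 1) (ρ : ℝ)
    {Q : Fin H → S → A → S → ℝ} (hQ : ∀ h s a, Q h s a ∈ stdSimplex ℝ S) (j : Fin (H + 1))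
    (s : S) : rpvlValue r ρ Q j s ∈ Set.Icc (0 : ℝ) H := by
  -- The induction needs the sharper bound by the number of remaining rewards.
  suffices h : ∀ s, rpvlValue r ρ Q j s ∈ Set.Icc (0 : ℝ) (H - j) from
    ⟨(h s).1, (h s).2.trans (by simp)⟩
  induction j using Fin.reverseInduction with
  | last => simp [rpvlValue_last]
  | cast h ih =>
    intro s
    rw [rpvlValue_castSucc]
    have hb : ∀ a, robustQ r ρ Q (rpvlValue r ρ Q h.succ) h s a ∈
        Set.Icc (0 : ℝ) (H - (h.castSucc : ℕ)) := by
      intro a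
      have h1 := worst_mem_Icc (ρ := ρ) (hQ h s a) ih
      have h2 := hr h s a
      simp only [Fin.val_succ, Nat.cast_add, Nat.cast_one, Set.mem_Icc, Fin.val_castSucc,
        robustQ] at *
      constructor <;> linarith
    obtain ⟨a₀⟩ := ‹Nonempty A›
    exact ⟨(hb a₀).1.trans (le_ciSup (f := fun a => robustQ r ρ Q (rpvlValue r ρ Q h.succ) h s a)
      (Set.finite_range _).bddAbove a₀),
      @ciSup_le _ _ _ ⟨a₀⟩ _ _ fun a => (hb a).2⟩

lemma expect_mono {S : Type*} [Fintype S] {P V V' : S → ℝ} (hP : P ∈ stdSimplex ℝ S)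
    (h : ∀ s, V s ≤ V' s) : expect P V ≤ expect P V' :=
  Finset.sum_le_sum fun s _ => mul_le_mul_of_nonneg_left (h s) (hP.1 s)

lemma expect_add_const {S : Type*} [Fintype S] {P : S → ℝ} (hP : P ∈ stdSimplex ℝ S) (V : S → ℝ)
    (c : ℝ) : expect P (fun s => V s + c) = expect P V + c := by
  simp_rw [expect, mul_add, Finset.sum_add_distrib, ← Finset.sum_mul, hP.2, one_mul]

section

variable {S A : Type*} [Fintype S] {H : ℕ}
  {r : Fin H → S → A → ℝ} {ρ e : ℝ} {P₀ Q : Fin H → S → A → S → ℝ}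

/-- Each backward step loses at most `e`: the greedy action attains the computed value, passing to
the nominal ball costs `e`, and any kernel of that ball does at least as well as the worst one. -/
lemma rpvlValue_sub_le_tailValue [Finite A] [Nonempty A] (hr : ∀ h s a, r h s a ∈ Set.Icc (0 : ℝ) 1)
    (hQ : ∀ h s a, Q h s a ∈ stdSimplex ℝ S)
    (he : ∀ h s a, worst (chiSqBall ρ (Q h s a)) (rpvlValue r ρ Q h.succ) ≤
      worst (chiSqBall ρ (P₀ h s a)) (rpvlValue r ρ Q h.succ) + e)
    {π : Fin H → S → A}
    (hπ : ∀ h s a, robustQ r ρ Q (rpvlValue r ρ Q h.succ) h s a ≤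
      robustQ r ρ Q (rpvlValue r ρ Q h.succ) h s (π h s))
    {P : Fin H → S → A → S → ℝ} (hP : P ∈ uncertaintySet ρ P₀) (n j : ℕ) (hj : j + n = H)
    (s : S) : rpvlValue r ρ Q ⟨j, by omega⟩ s - n * e ≤ tailValue r P π n j s := by
  induction n generalizing j s with
  | zero =>
    have : (⟨j, by omega⟩ : Fin (H + 1)) = Fin.last H := Fin.ext (by simpa using hj)
    rw [this, rpvlValue_last]
    simp [tailValue, pathValue]
  | succ n ih =>
    have hjH : j < H := by omega
    set h : Fin H := ⟨j, hjH⟩ with hh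
    have hPs := fun h s a => (hP h s a).1
    rw [tailValue_succ r hPs π hj.le]
    change rpvlValue r ρ Q h.castSucc s - _ ≤ r h s (π h s) + expect (P h s (π h s)) _
    have h1 : rpvlValue r ρ Q h.castSucc s ≤
        robustQ r ρ Q (rpvlValue r ρ Q h.succ) h s (π h s) := by
      rw [rpvlValue_castSucc]
      exact ciSup_le fun a => hπ h s a
    have h2 := he h s (π h s)
    have h3 := worst_le_expect (hP h s (π h s)) fun s => rpvlValue_mem_Icc hr ρ hQ h.succ s
    have h4 : expect (P h s (π h s)) (rpvlValue r ρ Q h.succ) + -(n * e) ≤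
        expect (P h s (π h s)) (tailValue r P π n (j + 1)) := by
      rw [← expect_add_const (hPs h s _)]
      refine expect_mono (hPs h s _) fun s' => ?_
      rw [← sub_eq_add_neg]
      exact ih (j + 1) (by omega) s'
    unfold robustQ at h1
    push_cast
    linarith

/-- By rectangularity a single model can be nearly worst for all stages, states and actions at once.
It is chosen against the computed value functions, hence before the policy, so it bounds all
policies simultaneously. -/
lemma tailValue_le_rpvlValue_add [Finite A] (hQV : ∀ h s a, ∃ P ∈ chiSqBall ρ (P₀ h s a),
      expect P (rpvlValue r ρ Q h.succ) ≤
        worst (chiSqBall ρ (Q h s a)) (rpvlValue r ρ Q h.succ) + e) :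
    ∃ P ∈ uncertaintySet ρ P₀, ∀ (π : Fin H → S → A) (n j : ℕ) (hj : j + n = H) (s : S),
      tailValue r P π n j s ≤ rpvlValue r ρ Q ⟨j, by omega⟩ s + n * e := by
  choose P hP hle using hQV
  refine ⟨P, hP, fun π n => ?_⟩
  induction n with
  | zero =>
    intro j hj s
    have : (⟨j, by omega⟩ : Fin (H + 1)) = Fin.last H := Fin.ext (by simpa using hj)
    rw [this, rpvlValue_last]
    simp [tailValue, pathValue]
  | succ n ih =>
    intro j hj s
    have hjH : j < H := by omega
    set h : Fin H := ⟨j, hjH⟩ with hh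
    have hPs := fun h s a => (hP h s a).1
    rw [tailValue_succ r hPs π hj.le]
    change r h s (π h s) + expect (P h s (π h s)) _ ≤ rpvlValue r ρ Q h.castSucc s + _
    have h1 : robustQ r ρ Q (rpvlValue r ρ Q h.succ) h s (π h s) ≤
        rpvlValue r ρ Q h.castSucc s := by
      rw [rpvlValue_castSucc]
      exact le_ciSup (f := fun a => robustQ r ρ Q (rpvlValue r ρ Q h.succ) h s a)
        (Set.finite_range _).bddAbove (π h s)
    have h2 := hle h s (π h s)
    have h4 : expect (P h s (π h s)) (tailValue r P π n (j + 1)) ≤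
        expect (P h s (π h s)) (rpvlValue r ρ Q h.succ) + n * e := by
      rw [← expect_add_const (hPs h s _)]
      exact expect_mono (hPs h s _) fun s' => ih (j + 1) (by omega) s'
    unfold robustQ at h1
    push_cast
    linarith

lemma value_nonneg (hr : ∀ h s a, 0 ≤ r h s a) {P : Fin H → S → A → S → ℝ}
    (hP : ∀ h s a s', 0 ≤ P h s a s') (π : Fin H → S → A) (h : Fin H) (s : S) :
    0 ≤ value r P π h s :=
  Finset.sum_nonneg fun _ _ => mul_nonneg (Finset.prod_nonneg fun _ _ => hP _ _ _ _)
    (Finset.sum_nonneg fun _ _ => hr _ _ _)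

/-- If the worst-case expectations around the nominal and the estimated model are `e`-close on the
computed value functions, then a greedy policy is `2 H e`-optimal. -/
lemma abs_optRobustValue_sub_le [Finite A] [Nonempty A]
    (hr : ∀ h s a, r h s a ∈ Set.Icc (0 : ℝ) 1) (hρ : 0 < ρ)
    (he0 : 0 ≤ e) (hP₀ : ∀ h s a, P₀ h s a ∈ stdSimplex ℝ S)
    (hQ : ∀ h s a, Q h s a ∈ stdSimplex ℝ S)
    (he : ∀ h s a, |worst (chiSqBall ρ (P₀ h s a)) (rpvlValue r ρ Q h.succ) -
      worst (chiSqBall ρ (Q h s a)) (rpvlValue r ρ Q h.succ)| ≤ e)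
    {π : Fin H → S → A}
    (hπ : ∀ h s a, robustQ r ρ Q (rpvlValue r ρ Q h.succ) h s a ≤
      robustQ r ρ Q (rpvlValue r ρ Q h.succ) h s (π h s)) (h : Fin H) (s : S) :
    |optRobustValue r ρ P₀ h s - robustValue r ρ P₀ π h s| ≤ 2 * H * e := by
  have hne : Nonempty (uncertaintySet ρ P₀) :=
    ⟨⟨P₀, fun h s a => self_mem_chiSqBall (hP₀ h s a)⟩⟩
  have hle : robustValue r ρ P₀ π h s ≤ optRobustValue r ρ P₀ h s := by
    have : Finite (Fin H → S → A) := inferInstance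
    exact le_ciSup (f := fun π => robustValue r ρ P₀ π h s) (Set.finite_range _).bddAbove π
  have hHe : ((H - h : ℕ) : ℝ) * e ≤ H * e := by
    refine mul_le_mul_of_nonneg_right ?_ he0
    exact_mod_cast Nat.sub_le _ _
  have hlow : rpvlValue r ρ Q ⟨h, by omega⟩ s - H * e ≤ robustValue r ρ P₀ π h s := by
    refine le_ciInf fun P => ?_
    rw [value_eq_tailValue]
    have := rpvlValue_sub_le_tailValue (e := e) hr hQ
      (fun h s a => by linarith [(abs_le.1 (he h s a)).1]) hπ P.2 (H - h) h (by omega) s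
    linarith
  have hup : optRobustValue r ρ P₀ h s ≤ rpvlValue r ρ Q ⟨h, by omega⟩ s + H * e := by
    obtain ⟨P, hP, hval⟩ := tailValue_le_rpvlValue_add (r := r) (ρ := ρ) (P₀ := P₀) (Q := Q)
      (e := e) fun h s a => by
        obtain ⟨P, hP, hPe⟩ := exists_expect_eq_worst hρ (Nat.cast_nonneg H) (hP₀ h s a)
          fun s => rpvlValue_mem_Icc hr ρ hQ h.succ s
        exact ⟨P, hP, by linarith [(abs_le.1 (he h s a)).2]⟩
    refine ciSup_le fun π' => ?_
    have h1 : robustValue r ρ P₀ π' h s ≤ value r P π' h s :=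
      ciInf_le (f := fun P : uncertaintySet ρ P₀ => value r P.1 π' h s)
        ⟨0, by
          rintro _ ⟨P', rfl⟩
          exact value_nonneg (fun h s a => (hr h s a).1) (fun h s a => (P'.2 h s a).1.1) _ _ _⟩
        ⟨P, hP⟩
    rw [value_eq_tailValue] at h1
    have h2 := hval π' (H - h) h (by omega) s
    linarith
  rw [abs_of_nonneg (by linarith)]
  linarith

end

/-! ### Concentration of square roots of empirical means -/

section

variable {Ω : Type*} [MeasurableSpace Ω] {μ : Measure Ω} [IsProbabilityMeasure μ]

lemma integrable_exp_mul_of_mem_Icc {Y : Ω → ℝ} (hm : Measurable Y) {b : ℝ}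
    (hY : ∀ ω, Y ω ∈ Set.Icc 0 b) (t : ℝ) : Integrable (fun ω => Real.exp (t * Y ω)) μ := by
  refine Integrable.of_bound (by fun_prop) (Real.exp (|t| * b)) (ae_of_all _ fun ω => ?_)
  rw [Real.norm_eq_abs, Real.abs_exp, Real.exp_le_exp]
  exact mul_le_mul (le_abs_self t) (hY ω).2 (hY ω).1 (abs_nonneg t)

lemma mgf_le_of_mem_Icc {Y : Ω → ℝ} (hm : Measurable Y) (hY : ∀ ω, Y ω ∈ Set.Icc (0 : ℝ) 1)
    (t : ℝ) : mgf Y μ t ≤ Real.exp ((∫ ω, Y ω ∂μ) * (Real.exp t - 1)) := by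
  have hi : Integrable Y μ := by
    refine Integrable.of_bound (by fun_prop) 1 (ae_of_all _ fun ω => ?_)
    rw [Real.norm_eq_abs, abs_of_nonneg (hY ω).1]
    exact (hY ω).2
  calc mgf Y μ t ≤ ∫ ω, (1 + Y ω * (Real.exp t - 1)) ∂μ := by
        refine integral_mono (integrable_exp_mul_of_mem_Icc hm hY t)
          ((integrable_const 1).add (hi.mul_const _)) fun ω => ?_
        -- On `[0, 1]` the convex function `y ↦ exp (t y)` lies below its chord `1 + y (exp t - 1)`.
        have := convexOn_exp.2 (Set.mem_univ 0) (Set.mem_univ t)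
          (sub_nonneg.2 (hY ω).2) (hY ω).1 (by ring)
        simp only [smul_eq_mul, mul_zero, zero_add, Real.exp_zero, mul_one] at this
        rw [mul_comm t]
        linarith
    _ = 1 + (∫ ω, Y ω ∂μ) * (Real.exp t - 1) := by
        rw [integral_add (integrable_const 1) (hi.mul_const _), integral_mul_const]
        simp
    _ ≤ _ := by linarith [Real.add_one_le_exp ((∫ ω, Y ω ∂μ) * (Real.exp t - 1))]

variable {N : ℕ} {Y : Fin N → Ω → ℝ} {p : ℝ}

lemma mgf_sum_le (hind : iIndepFun Y μ) (hm : ∀ i, Measurable (Y i))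
    (hY : ∀ i ω, Y i ω ∈ Set.Icc (0 : ℝ) 1) (hp : ∀ i, ∫ ω, Y i ω ∂μ = p) (t : ℝ) :
    mgf (∑ i, Y i) μ t ≤ Real.exp (N * (p * (Real.exp t - 1))) := by
  rw [hind.mgf_sum hm Finset.univ]
  calc ∏ i, mgf (Y i) μ t ≤ ∏ _i : Fin N, Real.exp (p * (Real.exp t - 1)) :=
        Finset.prod_le_prod (fun i _ => mgf_nonneg (μ := μ)) fun i _ => by
          have := mgf_le_of_mem_Icc (μ := μ) (hm i) (hY i) t
          rwa [hp i] at this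
    _ = _ := by simp [Real.exp_nat_mul]

lemma integrable_exp_mul_sum_of_mem_Icc (hm : ∀ i, Measurable (Y i))
    (hY : ∀ i ω, Y i ω ∈ Set.Icc (0 : ℝ) 1) (t : ℝ) :
    Integrable (fun ω => Real.exp (t * (∑ i, Y i) ω)) μ := by
  simp only [Finset.sum_apply]
  refine integrable_exp_mul_of_mem_Icc (μ := μ) (b := N) (Finset.measurable_sum _ fun i _ => hm i)
    (fun ω => ?_) t
  refine ⟨Finset.sum_nonneg fun i _ => (hY i ω).1, ?_⟩
  calc ∑ i, Y i ω ≤ ∑ _i : Fin N, (1 : ℝ) := Finset.sum_le_sum fun i _ => (hY i ω).2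
    _ = N := by simp

lemma measureReal_le_sum_le (hind : iIndepFun Y μ) (hm : ∀ i, Measurable (Y i))
    (hY : ∀ i ω, Y i ω ∈ Set.Icc (0 : ℝ) 1) (hp : ∀ i, ∫ ω, Y i ω ∂μ = p) {t : ℝ} (ht : 0 ≤ t)
    (q : ℝ) : μ.real {ω | N * q ≤ ∑ i, Y i ω} ≤
      Real.exp (N * (p * (Real.exp t - 1) - t * q)) := by
  have h := measure_ge_le_exp_mul_mgf (X := ∑ i, Y i) (N * q) ht
    (integrable_exp_mul_sum_of_mem_Icc (μ := μ) hm hY t)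
  simp only [Finset.sum_apply] at h
  refine h.trans ((mul_le_mul_of_nonneg_left (mgf_sum_le hind hm hY hp t)
    (Real.exp_pos _).le).trans ?_)
  rw [← Real.exp_add]
  exact Real.exp_le_exp.2 (by linarith)

lemma measureReal_sum_le_le (hind : iIndepFun Y μ) (hm : ∀ i, Measurable (Y i))
    (hY : ∀ i ω, Y i ω ∈ Set.Icc (0 : ℝ) 1) (hp : ∀ i, ∫ ω, Y i ω ∂μ = p) {t : ℝ} (ht : t ≤ 0)
    (q : ℝ) : μ.real {ω | ∑ i, Y i ω ≤ N * q} ≤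
      Real.exp (N * (p * (Real.exp t - 1) - t * q)) := by
  have h := measure_le_le_exp_mul_mgf (X := ∑ i, Y i) (N * q) ht
    (integrable_exp_mul_sum_of_mem_Icc (μ := μ) hm hY t)
  simp only [Finset.sum_apply] at h
  refine h.trans ((mul_le_mul_of_nonneg_left (mgf_sum_le hind hm hY hp t)
    (Real.exp_pos _).le).trans ?_)
  rw [← Real.exp_add]
  exact Real.exp_le_exp.2 (by linarith)

/-- The Chernoff exponent at `t = log (b / a)`, for the mean `a ^ 2` and the threshold `b ^ 2`. -/
lemma chernoff_exponent_le {a b : ℝ} (ha : 0 < a) (hb : 0 < b) :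
    a ^ 2 * (Real.exp (Real.log (b / a)) - 1) - Real.log (b / a) * b ^ 2 ≤ -(b - a) ^ 2 := by
  -- Bounding the logarithm of the inverse ratio turns the exponent into `2 a b - a² - b²`, a
  -- perfect square.
  have h1 : Real.log (a / b) ≤ a / b - 1 := Real.log_le_sub_one_of_pos (div_pos ha hb)
  have h2 : Real.log (b / a) = -Real.log (a / b) := by rw [← Real.log_inv, inv_div]
  rw [Real.exp_log (div_pos hb ha), h2]
  have h3 : Real.log (a / b) * b ^ 2 ≤ (a / b - 1) * b ^ 2 :=
    mul_le_mul_of_nonneg_right h1 (sq_nonneg b)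
  have h4 : a ^ 2 * (b / a - 1) = a * b - a ^ 2 := by field_simp
  have h5 : (a / b - 1) * b ^ 2 = a * b - b ^ 2 := by field_simp
  nlinarith

/-- Concentration of the square root of an empirical mean of `[0, 1]`-valued variables. -/
lemma measureReal_abs_sqrt_mean_sub_le (hN : 0 < N) (hind : iIndepFun Y μ)
    (hm : ∀ i, Measurable (Y i)) (hY : ∀ i ω, Y i ω ∈ Set.Icc (0 : ℝ) 1)
    (hp : ∀ i, ∫ ω, Y i ω ∂μ = p) {τ : ℝ} (hτ : 0 < τ) :
    μ.real {ω | τ < |√((∑ i, Y i ω) / N) - √p|} ≤ 2 * Real.exp (-(N * τ ^ 2)) := by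
  have hN' : (0 : ℝ) < N := by exact_mod_cast hN
  have hp0 : 0 ≤ p := by
    rw [← hp ⟨0, hN⟩]
    exact integral_nonneg fun ω => (hY _ ω).1
  have hup : μ.real {ω | N * (√p + τ) ^ 2 ≤ ∑ i, Y i ω} ≤ Real.exp (-(N * τ ^ 2)) := by
    rcases hp0.eq_or_lt with h0 | hpos
    -- For mean zero the optimal `t` is undefined; `t = 1` already gives the exponent `-N τ²`.
    · refine (measureReal_le_sum_le hind hm hY hp zero_le_one _).trans (Real.exp_le_exp.2 ?_)
      rw [← h0]
      simp
    · have ha : 0 < √p := Real.sqrt_pos.2 hpos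
      have hlog : 0 ≤ Real.log ((√p + τ) / √p) :=
        Real.log_nonneg ((one_le_div ha).2 (by linarith))
      refine (measureReal_le_sum_le hind hm hY hp hlog _).trans (Real.exp_le_exp.2 ?_)
      have := chernoff_exponent_le ha (by linarith : 0 < √p + τ)
      rw [Real.sq_sqrt hp0] at this
      nlinarith
  have hlow : μ.real {ω | √((∑ i, Y i ω) / N) < √p - τ} ≤ Real.exp (-(N * τ ^ 2)) := by
    rcases le_or_gt (√p) τ with h0 | hpos
    · have : {ω | √((∑ i, Y i ω) / N) < √p - τ} = ∅ := by
        refine Set.eq_empty_of_forall_notMem fun ω hω => ?_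
        have : √((∑ i, Y i ω) / N) < √p - τ := hω
        linarith [Real.sqrt_nonneg ((∑ i, Y i ω) / N)]
      rw [this, measureReal_empty]
      positivity
    · have ha : 0 < √p := hτ.trans hpos
      have hb : 0 < √p - τ := by linarith
      have hlog : Real.log ((√p - τ) / √p) ≤ 0 :=
        Real.log_nonpos (div_nonneg hb.le ha.le) ((div_le_one ha).2 (by linarith))
      refine (measureReal_mono ?_).trans
        ((measureReal_sum_le_le hind hm hY hp hlog ((√p - τ) ^ 2)).trans (Real.exp_le_exp.2 ?_))
      · intro ω hω
        have h1 := (Real.sqrt_lt' hb).1 hω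
        rw [div_lt_iff₀ hN'] at h1
        exact h1.le.trans_eq (mul_comm _ _)
      · have := chernoff_exponent_le ha hb
        rw [Real.sq_sqrt hp0] at this
        nlinarith
  calc μ.real {ω | τ < |√((∑ i, Y i ω) / N) - √p|}
      ≤ μ.real ({ω | N * (√p + τ) ^ 2 ≤ ∑ i, Y i ω} ∪ {ω | √((∑ i, Y i ω) / N) < √p - τ}) := by
        refine measureReal_mono fun ω hω => ?_
        rcases lt_abs.1 (show τ < |√((∑ i, Y i ω) / N) - √p| from hω) with h | h
        · left
          have h1 := (Real.lt_sqrt (by positivity)).1 (by linarith :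
            √p + τ < √((∑ i, Y i ω) / N))
          rw [lt_div_iff₀ hN'] at h1
          exact (mul_comm _ _).trans_le h1.le
        · right
          change √((∑ i, Y i ω) / N) < √p - τ
          linarith
    _ ≤ _ := (measureReal_union_le _ _).trans (by linarith)

/-- A bound on the probability of an event that depends on two independent variables with finitely
many values holds if it holds for every fixed value of the first variable. -/
lemma measureReal_mem_le_of_indepFun {α β : Type*} [Fintype α] [MeasurableSpace α]
    [MeasurableSingletonClass α] [MeasurableSpace β] [DiscreteMeasurableSpace β] {W : Ω → α}
    {Z : Ω → β} (hW : Measurable W) (hind : IndepFun W Z μ) {B : α → Set β} {c : ℝ}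
    (h : ∀ w, μ.real (Z ⁻¹' B w) ≤ c) : μ.real {ω | Z ω ∈ B (W ω)} ≤ c := by
  calc μ.real {ω | Z ω ∈ B (W ω)} ≤ μ.real (⋃ w : α, W ⁻¹' {w} ∩ Z ⁻¹' B w) :=
        measureReal_mono fun ω hω => Set.mem_iUnion.2 ⟨W ω, rfl, hω⟩
    _ ≤ ∑ w, μ.real (W ⁻¹' {w} ∩ Z ⁻¹' B w) := measureReal_iUnion_fintype_le _
    _ = ∑ w, μ.real (W ⁻¹' {w}) * μ.real (Z ⁻¹' B w) := by
        refine Finset.sum_congr rfl fun w _ => ?_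
        simp only [measureReal_def]
        rw [hind.measure_inter_preimage_eq_mul _ _ (measurableSet_singleton w)
          (MeasurableSet.of_discrete), ENNReal.toReal_mul]
    _ ≤ ∑ w, μ.real (W ⁻¹' {w}) * c :=
        Finset.sum_le_sum fun w _ => mul_le_mul_of_nonneg_left (h w) measureReal_nonneg
    _ = c := by
        rw [← Finset.sum_mul, sum_measureReal_preimage_singleton Finset.univ
          fun w _ => hW (measurableSet_singleton w)]
        simp

end

/-! ### Empirical shortfall moments, independence of stages, union bound -/

lemma shortfallSq_empirical {S A : Type*} [Fintype S] [DecidableEq S] {H N : ℕ}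
    (x : Fin H → S → A → Fin N → S) (V : S → ℝ) (η : ℝ) (h : Fin H) (s : S) (a : A) :
    shortfallSq (empirical x h s a) V η = (∑ i, (max (η - V (x h s a i)) 0) ^ 2) / N := by
  simp only [shortfallSq, empirical, div_mul_eq_mul_div]
  rw [← Finset.sum_div, ← Finset.sum_fiberwise' (s := Finset.univ) (x h s a)
    fun s' => (max (η - V s') 0) ^ 2]
  simp

lemma empirical_mem_stdSimplex {S A : Type*} [Fintype S] [DecidableEq S] {H N : ℕ} (hN : 0 < N)
    (x : Fin H → S → A → Fin N → S) (h : Fin H) (s : S) (a : A) :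
    empirical x h s a ∈ stdSimplex ℝ S := by
  refine ⟨fun s' => div_nonneg (Nat.cast_nonneg _) (Nat.cast_nonneg _), ?_⟩
  simp only [empirical]
  rw [← Finset.sum_div, ← Nat.cast_sum,
    ← Finset.card_eq_sum_card_fiberwise (f := x h s a) (fun _ _ => Finset.mem_univ _)]
  have : (N : ℝ) ≠ 0 := by exact_mod_cast hN.ne'
  simp [this]

section

variable {S Ω : Type*} [Fintype S] [MeasurableSpace S] [MeasurableSingletonClass S]
  [MeasurableSpace Ω] {μ : Measure Ω} [IsProbabilityMeasure μ]

lemma integral_comp_eq_expect {Z : Ω → S} (hZ : Measurable Z) {P : S → ℝ}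
    (hlaw : ∀ s, μ.real {ω | Z ω = s} = P s) (f : S → ℝ) : ∫ ω, f (Z ω) ∂μ = expect P f := by
  have := Measure.isProbabilityMeasure_map (μ := μ) hZ.aemeasurable
  rw [← integral_map hZ.aemeasurable (f := f) (measurable_of_finite f).aestronglyMeasurable,
    integral_fintype (Integrable.of_finite)]
  refine Finset.sum_congr rfl fun s _ => ?_
  rw [map_measureReal_apply hZ (measurableSet_singleton s), ← hlaw s]
  rfl

/-- Dividing the shortfalls by `K` puts their squares in `[0, 1]`; the square roots of the moments,
and hence the deviation `τ`, scale by the same factor. -/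
lemma measureReal_abs_sqrt_shortfall_sub_le {N : ℕ} (hN : 0 < N) {Z : Fin N → Ω → S}
    (hm : ∀ i, Measurable (Z i)) (hind : iIndepFun Z μ) {P : S → ℝ}
    (hlaw : ∀ i s, μ.real {ω | Z i ω = s} = P s) (V : S → ℝ) {η K τ : ℝ} (hK : 0 < K) (hτ : 0 < τ)
    (hVK : ∀ s, max (η - V s) 0 ≤ K) :
    μ.real {ω | τ < |√((∑ i, (max (η - V (Z i ω)) 0) ^ 2) / N) - √(shortfallSq P V η)|} ≤
      2 * Real.exp (-(N * (τ / K) ^ 2)) := by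
  set f : S → ℝ := fun s => (max (η - V s) 0 / K) ^ 2 with hf
  have hf01 : ∀ s, f s ∈ Set.Icc (0 : ℝ) 1 := fun s =>
    ⟨sq_nonneg _, pow_le_one₀ (div_nonneg (le_max_right _ _) hK.le) ((div_le_one hK).2 (hVK s))⟩
  have hfm : Measurable f := measurable_of_finite f
  have hp : ∀ i, ∫ ω, f (Z i ω) ∂μ = shortfallSq P V η / K ^ 2 := by
    intro i
    rw [integral_comp_eq_expect (hm i) (hlaw i), expect, shortfallSq, Finset.sum_div]
    exact Finset.sum_congr rfl fun s _ => by simp only [hf]; ring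
  refine le_trans (measureReal_mono ?_) (measureReal_abs_sqrt_mean_sub_le (μ := μ)
    (Y := fun i ω => f (Z i ω)) hN (hind.comp (fun _ => f) fun _ => hfm)
    (fun i => hfm.comp (hm i)) (fun i ω => hf01 _) hp (div_pos hτ hK))
  intro ω hω
  have h1 : (∑ i, f (Z i ω)) / N = (∑ i, (max (η - V (Z i ω)) 0) ^ 2) / N / K ^ 2 := by
    simp only [hf, div_pow]
    rw [← Finset.sum_div]
    ring
  change τ / K < |√((∑ i, f (Z i ω)) / N) - √(shortfallSq P V η / K ^ 2)|
  rw [h1, Real.sqrt_div' _ (sq_nonneg K), Real.sqrt_div' _ (sq_nonneg K), Real.sqrt_sq hK.le,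
    ← sub_div, abs_div, abs_of_pos hK]
  exact div_lt_div_of_pos_right hω hK

end

section

variable {S A Ω : Type*} [Fintype S] [DecidableEq S] [MeasurableSpace S]
  [MeasurableSingletonClass S] [Fintype A] [Nonempty A] [MeasurableSpace Ω] {μ : Measure Ω}
  [IsProbabilityMeasure μ] {H N : ℕ} {r : Fin H → S → A → ℝ} {P₀ : Fin H → S → A → S → ℝ}
  {X : Fin H → S → A → Fin N → Ω → S}

/-- The samples of stage `h` are independent of the value function computed for the next stage, so
the empirical shortfall moments of the latter concentrate. -/
lemma measureReal_abs_sqrt_shortfall_rpvlValue_sub_le (hN : 0 < N)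
    (hr : ∀ h s a, r h s a ∈ Set.Icc (0 : ℝ) 1) (hX : IsGenerativeSample μ P₀ X) (ρ : ℝ)
    {η K τ : ℝ} (hK : 0 < K) (hτ : 0 < τ) (hη : η ≤ K) (h : Fin H) (s : S) (a : A) :
    μ.real {ω | τ <
      |√(shortfallSq (empirical (fun h s a i => X h s a i ω) h s a)
          (rpvlValue r ρ (empirical fun h s a i => X h s a i ω) h.succ) η) -
        √(shortfallSq (P₀ h s a)
          (rpvlValue r ρ (empirical fun h s a i => X h s a i ω) h.succ) η)|} ≤
      2 * Real.exp (-(N * (τ / K) ^ 2)) := by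
  classical
  let T : Finset (Fin H × S × A × Fin N) := Finset.univ.filter fun j => h < j.1
  let T' : Finset (Fin H × S × A × Fin N) := Finset.univ.filter fun j => j.1 = h
  have hT : ∀ {h' : Fin H} (s' : S) (a' : A) (i : Fin N), h < h' → (h', s', a', i) ∈ T :=
    fun s' a' i hh => Finset.mem_filter.2 ⟨Finset.mem_univ _, hh⟩
  have hT' : ∀ i : Fin N, (h, s, a, i) ∈ T' :=
    fun i => Finset.mem_filter.2 ⟨Finset.mem_univ _, rfl⟩
  have hTT' : Disjoint T T' := by
    refine Finset.disjoint_left.2 fun j hj hj' => ?_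
    exact (Finset.mem_filter.1 hj).2.ne' (Finset.mem_filter.1 hj').2
  -- The value function of the next stage as a function of the later samples alone. The filler `s`
  -- at stages up to `h` is never read by the recursion, but keeps every empirical kernel a
  -- probability vector.
  let V : (T → S) → S → ℝ := fun w => rpvlValue r ρ
    (empirical fun h' s' a' i => if hh : h < h' then w ⟨(h', s', a', i), hT s' a' i hh⟩ else s)
    h.succ
  let B : (T → S) → Set (T' → S) := fun w => {z | τ <
    |√((∑ i, (max (η - V w (z ⟨(h, s, a, i), hT' i⟩)) 0) ^ 2) / N) -
      √(shortfallSq (P₀ h s a) (V w) η)|}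
  let Y : Fin H × S × A × Fin N → Ω → S := fun j => X j.1 j.2.1 j.2.2.1 j.2.2.2
  have hYm : ∀ j, Measurable (Y j) := fun j => hX.measurable _ _ _ _
  have hind : IndepFun (fun ω (j : T) => Y j ω) (fun ω (j : T') => Y j ω) μ :=
    hX.indep.indepFun_finset T T' hTT' hYm
  have hVeq : ∀ ω, rpvlValue r ρ (empirical fun h s a i => X h s a i ω) h.succ =
      V fun j => Y j ω := by
    intro ω
    refine rpvlValue_congr r ρ _ fun h' hh' => ?_
    have hlt : h < h' := Fin.succ_le_castSucc_iff.1 hh'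
    funext s' a' s''
    simp only [empirical, hlt, dif_pos, Y]
  have key := measureReal_mem_le_of_indepFun (μ := μ) (B := B)
    (c := 2 * Real.exp (-(N * (τ / K) ^ 2)))
    (measurable_pi_lambda _ fun j : T => hYm j) hind fun w => by
      have hinj : Function.Injective fun i : Fin N => (h, s, a, i) := fun i i' hii => by
        simpa using hii
      refine measureReal_abs_sqrt_shortfall_sub_le (μ := μ) (Z := X h s a) (P := P₀ h s a) hN
        (hX.measurable h s a) (hX.indep.precomp (g := fun i : Fin N => (h, s, a, i)) hinj) (hX.law h s a) (V w) hK hτ fun s' => ?_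
      have := (rpvlValue_mem_Icc hr ρ (empirical_mem_stdSimplex hN fun h' s' a' i =>
        if hh : h < h' then w ⟨(h', s', a', i), hT s' a' i hh⟩ else s) h.succ s').1
      exact max_le (by change η - rpvlValue r ρ _ h.succ s' ≤ K; linarith) hK.le
  refine le_of_eq_of_le ?_ key
  congr 1
  ext ω
  simp only [Set.mem_ofPred_eq, hVeq, shortfallSq_empirical, B, Y]

/-- With high probability the worst-case expectations around the nominal and around the empirical
model agree, on the computed value functions, up to `C τ + θ`. -/
lemma measureReal_exists_lt_abs_worst_sub_le (hN : 0 < N) (hH : 0 < H)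
    (hr : ∀ h s a, r h s a ∈ Set.Icc (0 : ℝ) 1) (hP₀ : ∀ h s a, P₀ h s a ∈ stdSimplex ℝ S)
    (hX : IsGenerativeSample μ P₀ X) {ρ K τ θ : ℝ} (hρ : 0 < ρ)
    (hK : K = √(1 + ρ) * H / (√(1 + ρ) - 1)) (hτ : 0 < τ) (hθ : 0 < θ) :
    μ.real {ω | ∃ h s a, √(1 + ρ) * τ + θ <
      |worst (chiSqBall ρ (P₀ h s a))
          (rpvlValue r ρ (empirical fun h s a i => X h s a i ω) h.succ) -
        worst (chiSqBall ρ (empirical (fun h s a i => X h s a i ω) h s a))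
          (rpvlValue r ρ (empirical fun h s a i => X h s a i ω) h.succ)|} ≤
      H * Fintype.card S * Fintype.card A * (1 + K / θ) *
        (2 * Real.exp (-(N * (τ / K) ^ 2))) := by
  have hC : 1 < √(1 + ρ) := Real.lt_sqrt_of_sq_lt (by linarith)
  have hH' : (0 : ℝ) < H := by exact_mod_cast hH
  have hK0 : 0 < K := hK ▸ div_pos (mul_pos (by linarith) hH') (by linarith)
  -- The grid points `k θ` in `[0, K]`, including `0`, number `⌊K / θ⌋ + 1`; hence the factor `1 + K
  -- / θ`.
  let E : Fin H × S × A × Fin (⌊K / θ⌋₊ + 1) → Set Ω := fun j => {ω | τ <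
      |√(shortfallSq (empirical (fun h s a i => X h s a i ω) j.1 j.2.1 j.2.2.1)
          (rpvlValue r ρ (empirical fun h s a i => X h s a i ω) j.1.succ)
          ((j.2.2.2 : ℕ) * θ)) -
        √(shortfallSq (P₀ j.1 j.2.1 j.2.2.1)
          (rpvlValue r ρ (empirical fun h s a i => X h s a i ω) j.1.succ)
          ((j.2.2.2 : ℕ) * θ))|}
  have hE : ∀ j, μ.real (E j) ≤ 2 * Real.exp (-(N * (τ / K) ^ 2)) := by
    rintro ⟨h, s, a, k⟩
    refine measureReal_abs_sqrt_shortfall_rpvlValue_sub_le hN hr hX ρ hK0 hτ ?_ h s a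
    have h1 : ((k : ℕ) : ℝ) ≤ K / θ := by
      refine le_trans ?_ (Nat.floor_le (div_pos hK0 hθ).le)
      exact_mod_cast Nat.lt_succ_iff.1 k.2
    exact (le_div_iff₀ hθ).1 h1
  refine le_trans (measureReal_mono (μ := μ) (s₂ := ⋃ j, E j) ?_)
    ((measureReal_iUnion_fintype_le _).trans ((Finset.sum_le_sum fun j _ => hE j).trans ?_))
  · rintro ω ⟨h, s, a, hlt⟩
    by_contra hcon
    set Q := empirical fun h s a i => X h s a i ω
    have hQ := empirical_mem_stdSimplex hN fun h s a i => X h s a i ω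
    have hclose : ∀ k : ℕ, k * θ ≤ √(1 + ρ) * H / (√(1 + ρ) - 1) →
        |√(shortfallSq (Q h s a) (rpvlValue r ρ Q h.succ) (k * θ)) -
          √(shortfallSq (P₀ h s a) (rpvlValue r ρ Q h.succ) (k * θ))| ≤ τ := by
      intro k hk
      rw [← hK] at hk
      have hk' : k < ⌊K / θ⌋₊ + 1 :=
        Nat.lt_succ_iff.2 (Nat.le_floor ((le_div_iff₀ hθ).2 hk))
      by_contra hgt
      exact hcon (Set.mem_iUnion.2 ⟨(h, s, a, ⟨k, hk'⟩), not_le.1 hgt⟩)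
    have hV := rpvlValue_mem_Icc hr ρ hQ h.succ
    have h1 := worst_le_worst_add hρ hH'.le hθ (hP₀ h s a) (hQ h s a) hV (τ := τ)
      fun k hk => by linarith [(abs_le.1 (hclose k hk)).2]
    have h2 := worst_le_worst_add hρ hH'.le hθ (hQ h s a) (hP₀ h s a) hV (τ := τ)
      fun k hk => by linarith [(abs_le.1 (hclose k hk)).1]
    exact not_le.2 hlt (abs_le.2 ⟨by linarith, by linarith⟩)
  · rw [Finset.sum_const, Finset.card_univ, nsmul_eq_mul]
    refine mul_le_mul_of_nonneg_right ?_ (by positivity)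
    simp only [Fintype.card_prod, Fintype.card_fin]
    push_cast
    have h1 := Nat.floor_le (div_pos hK0 hθ).le
    calc (H : ℝ) * (Fintype.card S * (Fintype.card A * (⌊K / θ⌋₊ + 1)))
        = H * Fintype.card S * Fintype.card A * (1 + ⌊K / θ⌋₊) := by ring
      _ ≤ _ := by gcongr

end

end RobustMDP

/-! ### Choice of constants and conclusion -/

theorem theorem2 {S A Ω : Type*} [Fintype S] [Nonempty S] [DecidableEq S] [MeasurableSpace S]
    [MeasurableSingletonClass S] [Fintype A] [Nonempty A]
    [MeasurableSpace Ω] (μ : Measure Ω) [IsProbabilityMeasure μ]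
    (H N : ℕ) (r : Fin H → S → A → ℝ) (hr : ∀ h s a, r h s a ∈ Set.Icc (0 : ℝ) 1)
    (P₀ : Fin H → S → A → S → ℝ) (hP₀ : ∀ h s a, P₀ h s a ∈ stdSimplex ℝ S)
    (X : Fin H → S → A → Fin N → Ω → S) (hX : RobustMDP.IsGenerativeSample μ P₀ X)
    (δ ρ ε C : ℝ) (hδ : δ ∈ Set.Ioo (0 : ℝ) 1) (hρ : 0 < ρ)
    (hε : ε ∈ Set.Ioo (0 : ℝ) (8 * (H : ℝ))) (hC : C = Real.sqrt (1 + ρ))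
    (hN : 128 * C ^ 4 * (H : ℝ) ^ 5 * (Fintype.card S : ℝ) * (Fintype.card A : ℝ) /
          ((C - 1) ^ 2 * ε ^ 2) *
        Real.log (2 * (H : ℝ) * (Fintype.card S : ℝ) * (Fintype.card A : ℝ) *
          (1 + 8 * C * (H : ℝ) ^ 2 / (ε * (C - 1))) / δ) ≤
      (N : ℝ) * (Fintype.card S : ℝ) * (Fintype.card A : ℝ) * (H : ℝ)) :
    ENNReal.ofReal (1 - δ) ≤
      μ {ω | ∀ π : Fin H → S → A,
        RobustMDP.IsRPVLOutput r ρ (fun h s a i => X h s a i ω) π →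
        ∀ h s, |RobustMDP.optRobustValue r ρ P₀ h s - RobustMDP.robustValue r ρ P₀ π h s| ≤ ε} := by
  obtain ⟨hδ0, hδ1⟩ := hδ
  obtain ⟨hε0, hεH⟩ := hε
  have hC1 : 1 < C := hC ▸ Real.lt_sqrt_of_sq_lt (by linarith)
  have hC1' : 0 < C - 1 := by linarith
  have hC0 : 0 < C := by linarith
  -- The interval `(0, 8 H)` for `ε` is empty when `H = 0`.
  have hH : (0 : ℝ) < H := by linarith
  have hH1 : (1 : ℝ) ≤ H := by
    have : 0 < H := by exact_mod_cast hH
    exact_mod_cast this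
  have hS : (1 : ℝ) ≤ Fintype.card S := by exact_mod_cast Fintype.card_pos
  have hA : (1 : ℝ) ≤ Fintype.card A := by exact_mod_cast Fintype.card_pos
  set y : ℝ := 2 * (H : ℝ) * (Fintype.card S : ℝ) * (Fintype.card A : ℝ) *
    (1 + 8 * C * (H : ℝ) ^ 2 / (ε * (C - 1))) with hy
  have hy1 : 1 ≤ y := by
    have h1 : 0 ≤ 8 * C * (H : ℝ) ^ 2 / (ε * (C - 1)) := by positivity
    have h2 : 1 ≤ (H : ℝ) * Fintype.card S * Fintype.card A :=
      one_le_mul_of_one_le_of_one_le (one_le_mul_of_one_le_of_one_le hH1 hS) hA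
    rw [hy]
    nlinarith
  have hy0 : 0 < y := by linarith
  have hL : 0 < Real.log (y / δ) := Real.log_pos ((one_lt_div hδ0).2 (by linarith))
  -- `1 / D` is the rate `(τ / K)²` in the exponent. The sample size allows `2 D log (y / δ)`, twice
  -- what the tail bound requires.
  set D : ℝ := 64 * C ^ 4 * (H : ℝ) ^ 4 / ((C - 1) ^ 2 * ε ^ 2) with hD
  have hD0 : 0 < D := by positivity
  have hND : 2 * D * Real.log (y / δ) ≤ N := by
    have h1 : 0 < (Fintype.card S : ℝ) * (Fintype.card A : ℝ) * (H : ℝ) := by positivity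
    refine le_of_mul_le_mul_right ?_ h1
    calc _ = _ := by rw [hD]; ring
      _ ≤ _ := hN
      _ = _ := by ring
  have hN0 : 0 < N := by
    have : (0 : ℝ) < N := lt_of_lt_of_le (by positivity) hND
    exact_mod_cast this
  set K : ℝ := C * H / (C - 1) with hK
  have hK0 : 0 < K := by positivity
  -- With this `τ` and `θ`, the deviation term `C τ` and the grid term `θ` both equal `ε / (8 H)`,
  -- so the total error `2 H (C τ + θ)` is `ε / 2`.
  set τ : ℝ := ε / (8 * H * C) with hτ
  have hτ0 : 0 < τ := by positivity
  set θ : ℝ := ε / (8 * H) with hθ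
  have hθ0 : 0 < θ := by positivity
  have hKθ : K / θ = 8 * C * (H : ℝ) ^ 2 / (ε * (C - 1)) := by
    rw [hK, hθ]
    field_simp
  have hτK : (τ / K) ^ 2 = 1 / D := by
    rw [hτ, hK, hD]
    field_simp
    norm_num
  have hexp : Real.exp (-(N * (τ / K) ^ 2)) ≤ δ / y := by
    have h1 : Real.log (y / δ) ≤ N * (τ / K) ^ 2 := by
      rw [hτK, mul_one_div, le_div_iff₀ hD0]
      nlinarith
    calc Real.exp (-(N * (τ / K) ^ 2)) ≤ Real.exp (-Real.log (y / δ)) :=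
          Real.exp_le_exp.2 (neg_le_neg h1)
      _ = δ / y := by rw [← Real.log_inv, inv_div, Real.exp_log (div_pos hδ0 hy0)]
  have hbad := RobustMDP.measureReal_exists_lt_abs_worst_sub_le (μ := μ) hN0
    (by exact_mod_cast hH) hr hP₀ hX hρ (by rw [← hC]) hτ0 hθ0
  rw [← hC, hKθ] at hbad
  set bad := {ω | ∃ h s a, C * τ + θ <
      |RobustMDP.worst (RobustMDP.chiSqBall ρ (P₀ h s a))
          (RobustMDP.rpvlValue r ρ (RobustMDP.empirical fun h s a i => X h s a i ω) h.succ) -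
        RobustMDP.worst (RobustMDP.chiSqBall ρ
            (RobustMDP.empirical (fun h s a i => X h s a i ω) h s a))
          (RobustMDP.rpvlValue r ρ (RobustMDP.empirical fun h s a i => X h s a i ω) h.succ)|}
    with hbad_def
  have hbadδ : μ.real bad ≤ δ := by
    refine hbad.trans ?_
    calc _ = y * Real.exp (-(N * (τ / K) ^ 2)) := by rw [hy, hK]; ring
      _ ≤ y * (δ / y) := mul_le_mul_of_nonneg_left hexp hy0.le
      _ = δ := by field_simp
  set good := {ω | ∀ π : Fin H → S → A,
        RobustMDP.IsRPVLOutput r ρ (fun h s a i => X h s a i ω) π →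
        ∀ h s, |RobustMDP.optRobustValue r ρ P₀ h s - RobustMDP.robustValue r ρ P₀ π h s| ≤ ε}
    with hgood_def
  -- Covering the space and using subadditivity avoids any measurability claim about `good` or
  -- `bad`.
  have hcover : (Set.univ : Set Ω) ⊆ good ∪ bad := by
    intro ω _
    by_cases hω : ω ∈ bad
    · exact Or.inr hω
    · left
      intro π hπ h s
      refine (RobustMDP.abs_optRobustValue_sub_le (e := C * τ + θ) hr hρ (by positivity) hP₀
        (RobustMDP.empirical_mem_stdSimplex hN0 fun h s a i => X h s a i ω)
        (fun h s a => ?_) hπ h s).trans ?_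
      · by_contra hgt
        exact hω ⟨h, s, a, not_le.1 hgt⟩
      · have : 2 * (H : ℝ) * (C * τ + θ) = ε / 2 := by
          rw [hτ, hθ]
          field_simp
          norm_num
        linarith
  have h1 : 1 ≤ μ.real good + μ.real bad := by
    rw [← probReal_univ (μ := μ)]
    exact (measureReal_mono hcover).trans (measureReal_union_le _ _)
  exact ENNReal.ofReal_le_of_le_toReal (by rw [← measureReal_def]; linarith)
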